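/- Let $I=[0,1]$ and let $\mathbb{A},\mathbb{O},\mathbb{U}$ denote the set $I\times I$ with the following three topologies. * $\mathbb{A}$ (the Alexandroff square): the topology generated by the sets $\{x\}\times U$, where $x\in I$, $U\subseteq I$ is open (in the Euclidean topology of $I$) and $x\notin U$, together with the sets $(I\times U)\setminus(\{x_1,\dots,x_n\}\times I)$, where $U\subseteq I$ is open and $\{x_1,\dots,x_n\}\subseteq I$ is finite. * $\mathbb{O}$: the order topology of the lexicographic order, in which $(x,y)\preceq(s,t)$ if and only if $x<s$, or $x=s$ and $y\le t$. * $\mathbb{U}$: the topology induced from the Euclidean plane $\mathbb{R}^2$. For a topological space $X$ let $\mathcal{G}_X$ be the group of all homeomorphisms $X\to X$, for $x\in X$ let $\mathcal{G}_Xx=\{h(x):h\in\mathcal{G}_X\}$, and let $X/\mathcal{G}_X=\{\mathcal{G}_Xx:x\in X\}$ be the orbit space. Put $\Delta=\{(x,x):x\in I\}$, $P_1=(0,0)$, $P_2=(0,1)$, $P_3=(1,1)$, $P_4=(1,0)$, $L_1=\{0\}\times(0,1)$, $L_2=(0,1)\times\{1\}$, $L_3=\{1\}\times(0,1)$, $L_4=(0,1)\times\{0\}$,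 where $(0,1)$ as a factor of a product is the open interval. Then $$\mathbb{A}/\mathcal{G}_{\mathbb{A}}=\bigl\{\{P_1,P_3\},\ \{P_2,P_4\},\ L_1\cup L_3,\ L_2\cup L_4,\ \Delta\setminus\{P_1,P_3\},\ ((0,1)\times(0,1))\setminus\Delta\bigr\},$$ $$\mathbb{O}/\mathcal{G}_{\mathbb{O}}=\bigl\{\{P_1,P_3\},\ \{P_2,P_4\},\ L_1\cup L_3,\ L_2\cup L_4,\ (0,1)\times(0,1)\bigr\},$$ $$\mathbb{U}/\mathcal{G}_{\mathbb{U}}=\bigl\{(0,1)\times(0,1),\ \mathbb{U}\setminus((0,1)\times(0,1))\bigr\}.$$ -/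

import Mathlib

/-- The underlying set `[0,1] × [0,1]`. The three topologies below are all put on this set. -/
abbrev Square : Type := unitInterval × unitInterval

namespace Square

/-- The Alexandroff square topology: it is generated by the vertical sets `{x} × U` with `U` open in
`[0,1]` and `x ∉ U`, and by the horizontal strips `[0,1] × U`, with `U` open in `[0,1]`, from which
finitely many vertical lines have been removed. -/
@[reducible] def alexandroffTopology : TopologicalSpace Square :=
  TopologicalSpace.generateFrom
    ({V : Set Square | ∃ (x : unitInterval) (U : Set unitInterval),
        IsOpen U ∧ x ∉ U ∧ V = {x} ×ˢ U} ∪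
     {V : Set Square | ∃ (U F : Set unitInterval),
        IsOpen U ∧ F.Finite ∧ V = (Set.univ ×ˢ U) \ (F ×ˢ Set.univ)})

/-- The order topology of the lexicographic order on `[0,1] × [0,1]`. -/
@[reducible] def lexTopology : TopologicalSpace Square :=
  TopologicalSpace.induced toLex (Preorder.topology (unitInterval ×ₗ unitInterval))

/-- The topology induced from the Euclidean plane. -/
@[reducible] def euclideanTopology : TopologicalSpace Square :=
  TopologicalSpace.induced
    (fun p : Square => (!₂[(p.1 : ℝ), (p.2 : ℝ)] : EuclideanSpace ℝ (Fin 2))) inferInstance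

/-- The orbit of `x` under the group of all self-homeomorphisms of `X`. -/
def homeoOrbit {X : Type*} [TopologicalSpace X] (x : X) : Set X :=
  {y | ∃ h : X ≃ₜ X, h x = y}

/-- The orbit space of the set `X` with topology `τ`, under the group of all self-homeomorphisms
of `(X, τ)`: the set of all orbits. -/
def homeoOrbitSpace {X : Type*} (τ : TopologicalSpace X) : Set (Set X) :=
  Set.range (@homeoOrbit X τ)

/-- The diagonal. -/
def Δ : Set Square := {p | p.1 = p.2}

/-- The four corners. -/
def P₁ : Square := (0, 0)
def P₂ : Square := (0, 1)
def P₃ : Square := (1, 1)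
def P₄ : Square := (1, 0)

/-- The four sides, without the corners. -/
def L₁ : Set Square := {0} ×ˢ Set.Ioo 0 1
def L₂ : Set Square := Set.Ioo 0 1 ×ˢ {1}
def L₃ : Set Square := {1} ×ˢ Set.Ioo 0 1
def L₄ : Set Square := Set.Ioo 0 1 ×ˢ {0}

/-- The open square `(0,1) × (0,1)`. -/
def openSquare : Set Square := Set.Ioo 0 1 ×ˢ Set.Ioo 0 1

end Square

/-! A partition into nonempty sets is the orbit space once each set is invariant under all
homeomorphisms and lies in a single orbit (`homeoOrbitSpace_induced`).

Single orbits come from explicit maps. Increasing homeomorphisms of `I` act diagonally on 𝔸, where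
the diagonal must be respected, and independently on the two coordinates in 𝕆 and 𝕌. Half turns
exchange opposite sides of 𝔸 and 𝕆. For the boundary of 𝕌, a homeomorphism of the plane carries the
square to the disc, which is then rotated.

Invariance comes from topological descriptions. In 𝔸, the diagonal consists of the points without
separable neighbourhood; the vertical sides are found from connected sets meeting the diagonal in
one point that does not cut it; off the diagonal, the horizontal edges are the non-cut points. In 𝕆,
`P₁` and `P₃` are the points that fail to cut some neighbourhood, the vertical sides are what
connected separable sets reach from them, and separability singles out the ends of the other
columns. Boolean combinations of these sets give all classes. In 𝕌, a point is interior exactly when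
some circle-valued map on its complement has no continuous argument. -/

open Set Topology unitInterval

namespace Square

/-! ### Orbits and homeomorphism invariants -/

section Invariants

variable {X Y : Type*} [TopologicalSpace X]

/-- A set is invariant if every self-homeomorphism maps it into itself. -/
def IsInvariant (s : Set X) : Prop := ∀ (h : X ≃ₜ X) ⦃x : X⦄, x ∈ s → h x ∈ s

/-- Two points are equivalent if a self-homeomorphism maps one to the other. -/
def Homogeneous (x y : X) : Prop := ∃ h : X ≃ₜ X, h x = y

theorem Homogeneous.symm {x y : X} : Homogeneous x y → Homogeneous y x :=
  fun ⟨h, hx⟩ ↦ ⟨h.symm, by simp [← hx]⟩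

theorem Homogeneous.trans {x y z : X} : Homogeneous x y → Homogeneous y z → Homogeneous x z :=
  fun ⟨h, hx⟩ ⟨k, hy⟩ ↦ ⟨h.trans k, by simp [hx, hy]⟩

theorem Homogeneous.refl (x : X) : Homogeneous x x := ⟨Homeomorph.refl X, rfl⟩

theorem IsInvariant.apply_mem_iff {s : Set X} (hs : IsInvariant s) (h : X ≃ₜ X) {x : X} :
    h x ∈ s ↔ x ∈ s :=
  ⟨fun hx ↦ by simpa using hs h.symm hx, fun hx ↦ hs h hx⟩

theorem IsInvariant.compl {s : Set X} (hs : IsInvariant s) : IsInvariant sᶜ :=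
  fun h _ hx hx' ↦ hx ((hs.apply_mem_iff h).1 hx')

theorem IsInvariant.inter {s t : Set X} (hs : IsInvariant s) (ht : IsInvariant t) :
    IsInvariant (s ∩ t) :=
  fun h _ hx ↦ ⟨hs h hx.1, ht h hx.2⟩

theorem IsInvariant.image_eq {s : Set X} (hs : IsInvariant s) (h : X ≃ₜ X) : h '' s = s := by
  ext x
  refine ⟨?_, fun hx ↦ ⟨h.symm x, hs _ hx, by simp⟩⟩
  rintro ⟨y, hy, rfl⟩
  exact hs h hy

/-- Invariance bounds an orbit from above and `trans` bounds it from below, so the orbit of any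
point of `s ∈ S` is `s`. The bijection `e` lets each topology live on its own type `X`, while the
classes stay subsets of the plain square. -/
theorem homeoOrbitSpace_induced (e : Y ≃ X) (S : Set (Set Y))
    (cover : ∀ y, ∃ s ∈ S, y ∈ s) (nonempty : ∀ s ∈ S, s.Nonempty)
    (trans : ∀ s ∈ S, ∃ c, ∀ x ∈ s, Homogeneous (e x) c)
    (inv : ∀ s ∈ S, IsInvariant (e.symm ⁻¹' s)) :
    homeoOrbitSpace (TopologicalSpace.induced e inferInstance) = S := by
  let _ : TopologicalSpace Y := TopologicalSpace.induced e inferInstance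
  let E : Y ≃ₜ X := e.toHomeomorphOfIsInducing ⟨rfl⟩
  have hE : ∀ y, E y = e y := fun _ ↦ rfl
  have hE' : ∀ y, E.symm y = e.symm y := fun _ ↦ rfl
  have key : ∀ s ∈ S, ∀ x ∈ s, homeoOrbit x = s := by
    intro s hs x hx
    ext y
    constructor
    · rintro ⟨h, rfl⟩
      have := inv s hs ((E.symm.trans h).trans E) (x := e x) (by simpa using hx)
      simpa [← hE, ← hE'] using this
    · intro hy
      obtain ⟨c, hc⟩ := trans s hs
      obtain ⟨k, hk⟩ := (hc x hx).trans (hc y hy).symm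
      exact ⟨(E.trans k).trans E.symm, by simp [hE, hE', hk]⟩
  ext s
  constructor
  · rintro ⟨x, rfl⟩
    obtain ⟨s, hs, hx⟩ := cover x
    rwa [key s hs x hx]
  · intro hs
    obtain ⟨x, hx⟩ := nonempty s hs
    exact ⟨x, key s hs x hx⟩

variable (X) in
/-- The points with a separable neighbourhood. -/
def separablePoints : Set X := {p | ∃ U ∈ 𝓝 p, TopologicalSpace.IsSeparable U}

variable (X) in
theorem isInvariant_separablePoints : IsInvariant (separablePoints X) := by
  rintro h x ⟨U, hU, hs⟩
  exact ⟨h '' U, h.isOpenMap.image_mem_nhds hU, hs.image h.continuous⟩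

/-- A separable set meets only countably many fibres of a map in relatively open sets. -/
theorem countable_of_isSeparable {ι : Type*} (f : X → ι) {S : Set X}
    (hS : TopologicalSpace.IsSeparable S) {Z : Set ι}
    (h : ∀ z ∈ Z, ∃ O, IsOpen O ∧ (O ∩ S).Nonempty ∧ ∀ p ∈ O, f p = z) : Z.Countable := by
  obtain ⟨c, hc, hcS⟩ := hS
  refine (hc.image f).mono fun z hz ↦ ?_
  obtain ⟨O, hO, ⟨p, hpO, hpS⟩, hf⟩ := h z hz
  obtain ⟨q, hqO, hqc⟩ := mem_closure_iff.1 (hcS hpS) O hO hpO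
  exact ⟨q, hqc, hf q hqO⟩

end Invariants

/-! ### Homeomorphisms of the interval -/

/-- Piecewise linear interpolation with three positive slopes. Two points are prescribed at once
because on the Alexandroff square a single map has to move both coordinates. -/
theorem exists_orderIso_of_lt {x y x' y' : I} (hx : 0 < x) (hxy : x < y) (hy : y < 1)
    (hx' : 0 < x') (hxy' : x' < y') (hy' : y' < 1) :
    ∃ g : I ≃o I, g x = x' ∧ g y = y' := by
  obtain ⟨x, hx0, hx1⟩ := x
  obtain ⟨y, hy0, hy1⟩ := y
  obtain ⟨x', hx0', hx1'⟩ := x'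
  obtain ⟨y', hy0', hy1'⟩ := y'
  simp only [← Subtype.coe_lt_coe, Set.Icc.coe_zero, Set.Icc.coe_one] at hx hxy hy hx' hxy' hy'
  obtain ⟨a, ha, hax⟩ : ∃ a : ℝ, 0 < a ∧ a * x = x' := ⟨x' / x, by positivity, by field_simp⟩
  obtain ⟨b, hb, hbx⟩ : ∃ b : ℝ, 0 < b ∧ b * (y - x) = y' - x' :=
    ⟨(y' - x') / (y - x), div_pos (by linarith) (by linarith),
      div_mul_cancel₀ _ (by linarith)⟩
  obtain ⟨c, hc, hcx⟩ : ∃ c : ℝ, 0 < c ∧ c * (1 - y) = 1 - y' :=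
    ⟨(1 - y') / (1 - y), div_pos (by linarith) (by linarith),
      div_mul_cancel₀ _ (by linarith)⟩
  -- Each summand varies only on its own piece and is constant on the others, so all three are
  -- monotone and at every point one of them is strictly increasing to the right.
  let F : ℝ → ℝ := fun t ↦ a * min t x + b * (max (min t y) x - x) + c * (max t y - y)
  have hF : StrictMono F := by
    intro s t hst
    have h1 : a * min s x ≤ a * min t x := by gcongr
    have h2 : b * (max (min s y) x - x) ≤ b * (max (min t y) x - x) := by gcongr
    have h3 : c * (max s y - y) ≤ c * (max t y - y) := by gcongr
    change a * min s x + b * (max (min s y) x - x) + c * (max s y - y) <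
      a * min t x + b * (max (min t y) x - x) + c * (max t y - y)
    rcases lt_or_ge s x with hs | hs
    · have : a * min s x < a * min t x := by
        rw [min_eq_left hs.le]; exact mul_lt_mul_of_pos_left (lt_min hst hs) ha
      linarith
    rcases lt_or_ge s y with hs' | hs'
    · have : b * (max (min s y) x - x) < b * (max (min t y) x - x) := by
        rw [min_eq_left hs'.le, max_eq_left hs]
        exact mul_lt_mul_of_pos_left (sub_lt_sub_right (lt_max_of_lt_left (lt_min hst hs')) _) hb
      linarith
    · have : c * (max s y - y) < c * (max t y - y) := by
        rw [max_eq_left hs']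
        exact mul_lt_mul_of_pos_left (sub_lt_sub_right (lt_max_of_lt_left hst) _) hc
      linarith
  have F0 : F 0 = 0 := by
    simp only [F]; rw [min_eq_left hx.le, min_eq_left hy0, max_eq_right hx.le, max_eq_right hy0]
    ring
  have F1 : F 1 = 1 := by
    simp only [F]; rw [min_eq_right hx1, min_eq_right hy.le, max_eq_left hxy.le, max_eq_left hy.le]
    linarith
  have Fx : F x = x' := by
    simp only [F]; rw [min_self, min_eq_left hxy.le, max_self, max_eq_right hxy.le]
    linarith
  have Fy : F y = y' := by
    simp only [F]; rw [min_eq_right hxy.le, min_self, max_self, max_eq_left hxy.le]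
    linarith
  have Fm : ∀ t : I, F t ∈ Icc (0 : ℝ) 1 := fun t ↦
    ⟨F0 ▸ hF.monotone t.2.1, F1 ▸ hF.monotone t.2.2⟩
  let G : I → I := fun t ↦ ⟨F t, Fm t⟩
  have hG : StrictMono G := fun s t hst ↦ hF hst
  have Gc : Continuous G := by
    refine Continuous.subtype_mk ?_ _
    simp only [F]
    fun_prop
  have Gs : Function.Surjective G := fun t ↦
    mem_range_of_exists_le_of_exists_ge Gc
      ⟨0, Subtype.coe_le_coe.1 (by simpa [G, F0] using t.2.1)⟩
      ⟨1, Subtype.coe_le_coe.1 (by simpa [G, F1] using t.2.2)⟩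
  exact ⟨hG.orderIsoOfSurjective G Gs, Subtype.ext Fx, Subtype.ext Fy⟩

theorem exists_orderIso {x x' : I} (hx : x ∈ Ioo 0 1) (hx' : x' ∈ Ioo 0 1) :
    ∃ g : I ≃o I, g x = x' := by
  obtain ⟨y, h1, h2⟩ := exists_between hx.2
  obtain ⟨y', h1', h2'⟩ := exists_between hx'.2
  obtain ⟨g, hg, -⟩ := exists_orderIso_of_lt hx.1 h1 h2 hx'.1 h1' h2'
  exact ⟨g, hg⟩

@[simp] theorem orderIso_zero (g : I ≃o I) : g 0 = 0 := map_bot g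

@[simp] theorem orderIso_one (g : I ≃o I) : g 1 = 1 := map_top g

theorem half_mem_Ioo : (⟨1 / 2, by norm_num, by norm_num⟩ : I) ∈ Ioo (0 : I) 1 := by
  constructor <;> rw [← Subtype.coe_lt_coe] <;> norm_num

/-- The reflection of the unit interval as a homeomorphism. -/
def reflection : I ≃ₜ I where
  toFun := σ
  invFun := σ
  left_inv := symm_symm
  right_inv := symm_symm
  continuous_toFun := continuous_symm
  continuous_invFun := continuous_symm

theorem eq_zero_or_mem_Ioo_or_eq_one (x : I) : x = 0 ∨ x ∈ Ioo 0 1 ∨ x = 1 := by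
  rcases eq_or_lt_of_le (nonneg' (t := x)) with h | h
  · exact .inl h.symm
  rcases eq_or_lt_of_le (le_one' (t := x)) with h' | h'
  · exact .inr (.inr h')
  · exact .inr (.inl ⟨h, h'⟩)

theorem mem_Ioo_iff_ne {x : I} : x ∈ Ioo 0 1 ↔ x ≠ 0 ∧ x ≠ 1 := by
  rw [mem_Ioo, pos_iff_ne_zero, lt_iff_le_and_ne (b := (1 : I)), and_iff_right le_one']

theorem symm_mem_Ioo {x : I} (hx : x ∈ Ioo 0 1) : σ x ∈ Ioo 0 1 := by
  rw [mem_Ioo_iff_ne] at *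
  exact ⟨fun h ↦ hx.2 (by simpa using congrArg σ h), fun h ↦ hx.1 (by simpa using congrArg σ h)⟩

theorem not_countable_Ioo {x y : I} (h : x < y) : ¬ (Ioo x y).Countable := by
  intro hc
  have hx := x.2
  have hy := y.2
  have := hc.image ((↑) : I → ℝ)
  refine Cardinal.Real.Ioo_countable_iff.not.2 ?_ (this.mono (s₁ := Ioo (x : ℝ) y) ?_)
  · simpa using h
  · intro t ht
    exact ⟨⟨t, hx.1.trans ht.1.le, ht.2.le.trans hy.2⟩, ht, rfl⟩

/-! ### The Alexandroff square -/

/-- The Alexandroff square. -/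
def AlexandroffSquare : Type := Square

namespace AlexandroffSquare

instance : TopologicalSpace AlexandroffSquare := alexandroffTopology

/-- The point of the Alexandroff square with the given coordinates. -/
def mk (x y : I) : AlexandroffSquare := (x, y)

/-- The first coordinate. -/
def fst (p : AlexandroffSquare) : I := Prod.fst p

/-- The second coordinate. -/
def snd (p : AlexandroffSquare) : I := Prod.snd p

@[simp] theorem fst_mk (x y : I) : fst (mk x y) = x := rfl
@[simp] theorem snd_mk (x y : I) : snd (mk x y) = y := rfl
@[simp] theorem mk_fst_snd (p : AlexandroffSquare) : mk p.fst p.snd = p := rfl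

theorem ext {p q : AlexandroffSquare} (h : p.fst = q.fst) (h' : p.snd = q.snd) : p = q :=
  Prod.ext h h'

theorem isOpen_vertical {x : I} {U : Set I} (hU : IsOpen U) (hx : x ∉ U) :
    IsOpen {p : AlexandroffSquare | p.fst = x ∧ p.snd ∈ U} :=
  TopologicalSpace.isOpen_generateFrom_of_mem (.inl ⟨x, U, hU, hx, rfl⟩)

theorem isOpen_strip {U F : Set I} (hU : IsOpen U) (hF : F.Finite) :
    IsOpen {p : AlexandroffSquare | p.snd ∈ U ∧ p.fst ∉ F} := by
  refine TopologicalSpace.isOpen_generateFrom_of_mem (.inr ⟨U, F, hU, hF, ?_⟩)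
  ext p
  exact ⟨fun h ↦ ⟨⟨trivial, h.1⟩, fun h' ↦ h.2 h'.1⟩,
    fun h ↦ ⟨h.1.2, fun h' ↦ h.2 ⟨h', trivial⟩⟩⟩

theorem continuous_of_preimage {Z : Type*} [TopologicalSpace Z] {f : Z → AlexandroffSquare}
    (h₁ : ∀ (x : I) (U : Set I), IsOpen U → x ∉ U →
      IsOpen {z | (f z).fst = x ∧ (f z).snd ∈ U})
    (h₂ : ∀ U F : Set I, IsOpen U → F.Finite → IsOpen {z | (f z).snd ∈ U ∧ (f z).fst ∉ F}) :
    Continuous f := by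
  refine continuous_generateFrom_iff.2 ?_
  rintro _ (⟨x, U, hU, hx, rfl⟩ | ⟨U, F, hU, hF, rfl⟩)
  · exact h₁ x U hU hx
  · convert! h₂ U F hU hF using 1
    ext z
    exact ⟨fun h ↦ ⟨h.1.2, fun h' ↦ h.2 ⟨h', trivial⟩⟩,
      fun h ↦ ⟨⟨trivial, h.1⟩, fun h' ↦ h.2 h'.1⟩⟩

theorem continuous_snd : Continuous snd :=
  continuous_def.2 fun U hU ↦ by simpa using! isOpen_strip hU finite_empty

theorem continuous_mk (x : I) : Continuous (mk x) := by
  refine continuous_of_preimage (fun x' U hU _ ↦ ?_) fun U F hU _ ↦ ?_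
  · by_cases h : x = x' <;> simp [h, hU]
  · by_cases h : x ∈ F <;> simp [h, hU]

/-- Vertical generators miss the diagonal, and a strip pulls back to an open set minus a finite set.
-/
theorem continuous_diag : Continuous fun x ↦ mk x x := by
  refine continuous_of_preimage (fun x U hU hx ↦ ?_) fun U F hU hF ↦ ?_
  · convert! isOpen_empty
    ext z
    simp only [fst_mk, snd_mk, mem_ofPred_eq, mem_empty_iff_false, iff_false]
    rintro ⟨rfl, h⟩
    exact hx h
  · exact hU.inter hF.isClosed.isOpen_compl

/-- A homeomorphism of the interval acts diagonally on the Alexandroff square. -/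
def diagHomeo (g : I ≃ₜ I) : AlexandroffSquare ≃ₜ AlexandroffSquare where
  toFun p := mk (g p.fst) (g p.snd)
  invFun p := mk (g.symm p.fst) (g.symm p.snd)
  left_inv p := by simp
  right_inv p := by simp
  continuous_toFun := by
    refine continuous_of_preimage (fun x U hU hx ↦ ?_) fun U F hU hF ↦ ?_
    -- Using the same `g` on both coordinates is what preserves the condition `x ∉ U`.
    · convert! isOpen_vertical (x := g.symm x) (hU.preimage g.continuous) (by simpa using hx)
        using 1
      ext p
      simp [Homeomorph.eq_symm_apply]
    · exact isOpen_strip (hU.preimage g.continuous) (hF.preimage g.injective.injOn)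
  continuous_invFun := by
    refine continuous_of_preimage (fun x U hU hx ↦ ?_) fun U F hU hF ↦ ?_
    · convert! isOpen_vertical (x := g x) (hU.preimage g.symm.continuous) (by simpa using hx)
        using 1
      ext p
      simp [Homeomorph.symm_apply_eq]
    · exact isOpen_strip (hU.preimage g.symm.continuous) (hF.preimage g.symm.injective.injOn)

theorem homogeneous_of_homeo (g : I ≃ₜ I) (x y : I) : Homogeneous (mk x y) (mk (g x) (g y)) :=
  ⟨diagHomeo g, rfl⟩

theorem homogeneous_of_orderIso (g : I ≃o I) (x y : I) : Homogeneous (mk x y) (mk (g x) (g y)) :=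
  homogeneous_of_homeo g.toHomeomorph x y

theorem homogeneous_symm (x y : I) : Homogeneous (mk x y) (mk (σ x) (σ y)) :=
  homogeneous_of_homeo reflection x y

/-- The diagonal of the Alexandroff square. -/
def diagonal : Set AlexandroffSquare := {p | p.fst = p.snd}

/-- No vertical generator contains a diagonal point, so its basic neighbourhoods are strips, which
omit only finitely many columns. -/
theorem tendsto_mk_diag (x : I) :
    Filter.Tendsto (fun z ↦ mk z x) Filter.cofinite (𝓝 (mk x x)) := by
  refine TopologicalSpace.tendsto_nhds_generateFrom_iff.2 ?_
  rintro _ (⟨y, U, hU, hy, rfl⟩ | ⟨U, F, hU, hF, rfl⟩) h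
  · obtain ⟨h1, h2⟩ := h
    exact absurd h2 (by rwa [← show x = y from h1] at hy)
  · filter_upwards [hF.compl_mem_cofinite] with z hz
    exact ⟨⟨mem_univ _, h.1.2⟩, fun h ↦ hz h.1⟩

/-- A neighbourhood of a diagonal point meets all but finitely many columns in relatively open sets,
too many for a countable dense set. Off the diagonal, the column without its diagonal point is an
open neighbourhood inside a continuous image of `I`. -/
theorem separablePoints_eq : separablePoints AlexandroffSquare = diagonalᶜ := by
  ext p
  constructor
  · rintro ⟨U, hU, hs⟩ hp
    have hp : p = mk p.snd p.snd := ext hp rfl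
    generalize p.snd = x at hp
    subst hp
    have hev : ∀ᶠ z in Filter.cofinite, mk z x ∈ U := tendsto_mk_diag x hU
    have hfin : {z | mk z x ∉ U}.Finite := hev
    have hc : ({z | mk z x ∉ U} ∪ {x})ᶜ.Countable := by
      refine countable_of_isSeparable fst hs fun z hz ↦ ?_
      simp only [compl_union, mem_inter_iff, mem_compl_iff, mem_ofPred_eq, not_not,
        mem_singleton_iff] at hz
      exact ⟨_, isOpen_vertical (x := z) isOpen_compl_singleton (by simp),
        ⟨mk z x, ⟨rfl, fun h ↦ hz.2 h.symm⟩, hz.1⟩, fun q hq ↦ hq.1⟩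
    refine not_countable_Ioo (zero_lt_one (α := I)) ?_
    refine (hc.union (hfin.union (finite_singleton x)).countable).mono fun z _ ↦ ?_
    rw [compl_union_self]
    trivial
  · intro hp
    have : IsOpen {q : AlexandroffSquare | q.fst = p.fst ∧ q.snd ∈ ({p.fst}ᶜ : Set I)} :=
      isOpen_vertical isOpen_compl_singleton (by simp)
    refine ⟨_, this.mem_nhds ⟨rfl, fun h ↦ hp h.symm⟩,
      (TopologicalSpace.isSeparable_range (continuous_mk p.fst)).mono ?_⟩
    rintro q ⟨h, -⟩
    exact ⟨q.snd, ext h.symm rfl⟩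

theorem isInvariant_diagonal : IsInvariant diagonal := by
  have := (isInvariant_separablePoints AlexandroffSquare).compl
  rwa [separablePoints_eq, compl_compl] at this

theorem isPreconnected_range_mk (x : I) : IsPreconnected (range (mk x)) :=
  isPreconnected_range (continuous_mk x)

/-- A connected set meeting the diagonal in one point only is contained in a vertical line. -/
theorem fst_eq_of_isPreconnected {C : Set AlexandroffSquare} (hC : IsPreconnected C)
    {p q : AlexandroffSquare} (hp : p ∈ C) (h : C ∩ diagonal = {q}) : q.fst = p.fst := by
  by_contra hne
  have hq : q ∈ C ∩ diagonal := h ▸ mem_singleton q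
  have off : ∀ a ∈ C, a.fst = p.fst → a.snd ≠ p.fst := by
    intro a ha hap has
    have : a = q := by
      have : a ∈ C ∩ diagonal := ⟨ha, hap.trans has.symm⟩
      rwa [h] at this
    exact hne (this ▸ hap)
  -- The column of `p` without its diagonal point, and the complement of that column, are disjoint
  -- open sets that would separate `C`.
  obtain ⟨a, -, ha, ha'⟩ := hC {a | a.fst = p.fst ∧ a.snd ∈ ({p.fst}ᶜ : Set I)}
    {a | a.snd ∈ univ ∧ a.fst ∉ ({p.fst} : Set I)}
    (isOpen_vertical isOpen_compl_singleton (by simp)) (isOpen_strip isOpen_univ (by simp))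
    (fun a ha ↦ by
      by_cases hap : a.fst = p.fst
      · exact .inl ⟨hap, off a ha hap⟩
      · exact .inr ⟨trivial, hap⟩)
    ⟨p, hp, rfl, off p hp rfl⟩ ⟨q, hq.1, trivial, hne⟩
  exact ha'.2 ha.1

/-- The diagonal is a copy of `I`, with `snd` as continuous inverse of `z ↦ mk z z`, and only the
endpoints of `I` fail to cut it. -/
theorem isPreconnected_diagonal_diff_iff (x : I) :
    IsPreconnected (diagonal \ {mk x x}) ↔ x = 0 ∨ x = 1 := by
  have himg : diagonal \ {mk x x} = (fun z ↦ mk z z) '' {x}ᶜ := by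
    ext p
    constructor
    · rintro ⟨hp, hne⟩
      exact ⟨p.snd, fun h ↦ hne (ext (hp.trans h) h), ext (Eq.symm hp) rfl⟩
    · rintro ⟨z, hz, rfl⟩
      exact ⟨rfl, fun h ↦ hz (congrArg snd h)⟩
  constructor
  · intro h
    by_contra! hx
    obtain ⟨h0, h1⟩ := mem_Ioo_iff_ne.2 hx
    have h2 : IsPreconnected ({x}ᶜ : Set I) := by
      have := h.image snd continuous_snd.continuousOn
      simpa only [himg, image_image, snd_mk, image_id'] using this
    exact h2.Icc_subset (a := 0) (b := 1) h0.ne h1.ne' ⟨h0.le, h1.le⟩ rfl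
  · intro h
    rw [himg]
    refine IsPreconnected.image ?_ _ continuous_diag.continuousOn
    rcases h with rfl | rfl
    · convert! isPreconnected_Ioi (a := (0 : I))
      ext z
      simp [pos_iff_ne_zero]
    · convert! isPreconnected_Iio (a := (1 : I))
      ext z
      simp [lt_iff_le_and_ne, le_one']

/-- The points of the Alexandroff square whose vertical line is one of the two sides. -/
def sides : Set AlexandroffSquare := {p | p.fst = 0 ∨ p.fst = 1}

/-- The column through `p` is a possible `C`, and every `C` forces `q` to be the diagonal point of
that column. The right-hand side uses only connectedness and the invariant diagonal, which makes
`sides` invariant. -/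
theorem mem_sides_iff (p : AlexandroffSquare) : p ∈ sides ↔
    ∃ (q : AlexandroffSquare) (C : Set AlexandroffSquare), IsPreconnected C ∧ p ∈ C ∧
      C ∩ diagonal = {q} ∧ IsPreconnected (diagonal \ {q}) := by
  constructor
  · intro hp
    refine ⟨mk p.fst p.fst, range (mk p.fst), isPreconnected_range_mk _, ⟨p.snd, rfl⟩, ?_,
      (isPreconnected_diagonal_diff_iff _).2 hp⟩
    ext a
    constructor
    · rintro ⟨⟨y, rfl⟩, h⟩
      exact ext rfl (Eq.symm h)
    · rintro rfl
      exact ⟨⟨_, rfl⟩, rfl⟩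
  · rintro ⟨q, C, hC, hp, hq, h⟩
    have hqd : q ∈ C ∩ diagonal := hq ▸ mem_singleton q
    have hqp := fst_eq_of_isPreconnected hC hp hq
    have : q = mk p.fst p.fst := ext hqp (Eq.trans (Eq.symm hqd.2) hqp)
    rw [this, isPreconnected_diagonal_diff_iff] at h
    exact h

theorem isInvariant_sides : IsInvariant sides := by
  intro h p hp
  rw [mem_sides_iff] at hp ⊢
  obtain ⟨q, C, hC, hp, hq, hd⟩ := hp
  refine ⟨h q, h '' C, hC.image h h.continuous.continuousOn, mem_image_of_mem h hp, ?_, ?_⟩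
  · rw [← image_singleton, ← hq, image_inter h.injective, isInvariant_diagonal.image_eq]
  · have := hd.image h h.continuous.continuousOn
    rwa [image_sdiff h.injective, isInvariant_diagonal.image_eq, image_singleton] at this

/-- If `p` is inside its column, the part of the column beyond `p`, away from the diagonal, splits
off. If `p` is an end, every other point still reaches the connected diagonal along its own column.
-/
theorem isPreconnected_compl_iff {p : AlexandroffSquare} (hp : p ∉ diagonal) :
    IsPreconnected ({p}ᶜ : Set AlexandroffSquare) ↔ p.snd = 0 ∨ p.snd = 1 := by
  constructor
  · intro h
    by_contra! hy
    obtain ⟨h0, h1⟩ := mem_Ioo_iff_ne.2 hy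
    have hcol : IsOpen {a : AlexandroffSquare | a.fst ≠ p.fst} := by
      simpa using! isOpen_strip isOpen_univ (finite_singleton p.fst)
    -- `W` is the side of `p` containing the diagonal height, so `V` avoids that height and gives a
    -- vertical generator. The rest, all other columns together with the strip over `W`, is open
    -- too.
    have cut : ∀ V W : Set I, IsOpen V → IsOpen W → V ∪ W = {p.snd}ᶜ → Disjoint V W →
        p.fst ∈ W → V.Nonempty → False := by
      intro V W hV hW hVW hdis hpW hne
      have hpV : p.fst ∉ V := fun hpV ↦ disjoint_left.1 hdis hpV hpW
      have hcov : ∀ z, z ≠ p.snd → z ∈ V ∪ W := fun z hz ↦ hVW ▸ hz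
      have hpv : ∀ z ∈ V ∪ W, z ≠ p.snd := fun z hz ↦ by rwa [hVW] at hz
      obtain ⟨v, hv⟩ := hne
      obtain ⟨a, -, ha, ha'⟩ := h {a | a.fst = p.fst ∧ a.snd ∈ V}
        ({a | a.fst ≠ p.fst} ∪ snd ⁻¹' W) (isOpen_vertical hV hpV)
        (hcol.union (hW.preimage continuous_snd))
        (fun a ha ↦ by
          by_cases hap : a.fst = p.fst
          · rcases hcov a.snd fun h ↦ ha (ext hap h) with h | h
            · exact .inl ⟨hap, h⟩
            · exact .inr (.inr h)
          · exact .inr (.inl hap))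
        ⟨mk p.fst v, fun h ↦ hpv v (.inl hv) (congrArg snd h), rfl, hv⟩
        ⟨mk p.fst p.fst, fun h ↦ hp (congrArg snd h), .inr hpW⟩
      rcases ha' with ha' | ha'
      · exact ha' ha.1
      · exact disjoint_left.1 hdis ha.2 ha'
    rcases lt_or_gt_of_ne hp with hlt | hlt
    · exact cut (Ioi p.snd) (Iio p.snd) isOpen_Ioi isOpen_Iio (by rw [union_comm, Iio_union_Ioi])
        (disjoint_left.2 fun z h h' ↦ lt_asymm (a := z) (b := p.snd) h' h) hlt ⟨1, h1⟩
    · exact cut (Iio p.snd) (Ioi p.snd) isOpen_Iio isOpen_Ioi Iio_union_Ioi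
        (disjoint_left.2 fun z h h' ↦ lt_asymm (a := z) (b := p.snd) h h') hlt ⟨0, h0⟩
  · intro hy
    refine isPreconnected_of_forall (mk p.fst p.fst) fun q hq ↦
      ⟨range (fun z ↦ mk z z) ∪ mk q.fst '' uIcc q.fst q.snd, ?_, .inl ⟨_, rfl⟩,
        .inr ⟨q.snd, right_mem_uIcc, rfl⟩, ?_⟩
    · rintro a (⟨z, rfl⟩ | ⟨z, hz, rfl⟩) rfl
      · exact hp rfl
      · simp only [snd_mk] at hy
        -- An end of the column can lie on the segment from the diagonal to `q` only as an endpoint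
        -- of that segment.
        have : z = q.fst ∨ z = q.snd := by
          rw [mem_uIcc] at hz
          rcases hy with rfl | rfl
          · rcases hz with hz | hz
            · exact .inl (le_antisymm nonneg' hz.1)
            · exact .inr (le_antisymm nonneg' hz.1)
          · rcases hz with hz | hz
            · exact .inr (le_antisymm hz.2 le_one')
            · exact .inl (le_antisymm hz.2 le_one')
        rcases this with rfl | rfl
        · exact hp rfl
        · exact hq rfl
    · exact (isPreconnected_range continuous_diag).union (mk q.fst q.fst) ⟨_, rfl⟩
        ⟨q.fst, left_mem_uIcc, rfl⟩
        (isPreconnected_uIcc.image _ (continuous_mk _).continuousOn)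

/-- The points whose complement is connected. -/
def nonCutPoints : Set AlexandroffSquare := {p | IsPreconnected ({p}ᶜ : Set AlexandroffSquare)}

theorem isInvariant_nonCutPoints : IsInvariant nonCutPoints := by
  intro h p hp
  have := IsPreconnected.image hp h h.continuous.continuousOn
  rwa [image_compl_eq h.bijective, image_singleton] at this

/-! ### Transitivity on the classes, and the orbits of the Alexandroff square -/

theorem homogeneous_diag {x x' : I} (hx : x ∈ Ioo 0 1) (hx' : x' ∈ Ioo 0 1) :
    Homogeneous (mk x x) (mk x' x') := by
  obtain ⟨g, rfl⟩ := exists_orderIso hx hx'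
  exact homogeneous_of_orderIso g x x

theorem homogeneous_left {y y' : I} (hy : y ∈ Ioo 0 1) (hy' : y' ∈ Ioo 0 1) :
    Homogeneous (mk 0 y) (mk 0 y') := by
  obtain ⟨g, rfl⟩ := exists_orderIso hy hy'
  simpa using homogeneous_of_orderIso g 0 y

theorem homogeneous_bottom {x x' : I} (hx : x ∈ Ioo 0 1) (hx' : x' ∈ Ioo 0 1) :
    Homogeneous (mk x 0) (mk x' 0) := by
  obtain ⟨g, rfl⟩ := exists_orderIso hx hx'
  simpa using homogeneous_of_orderIso g x 0

theorem homogeneous_of_lt {x y x' y' : I} (hx : 0 < x) (hxy : x < y) (hy : y < 1)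
    (hx' : 0 < x') (hxy' : x' < y') (hy' : y' < 1) : Homogeneous (mk x y) (mk x' y') := by
  obtain ⟨g, rfl, rfl⟩ := exists_orderIso_of_lt hx hxy hy hx' hxy' hy'
  exact homogeneous_of_orderIso g x y

/-- The identity, from the plain square to the Alexandroff square. -/
def equivSquare : Square ≃ AlexandroffSquare := Equiv.refl Square

theorem orbitSpace_eq : homeoOrbitSpace alexandroffTopology =
    {{P₁, P₃}, {P₂, P₄}, L₁ ∪ L₃, L₂ ∪ L₄, Δ \ {P₁, P₃}, openSquare \ Δ} := by
  have hind : alexandroffTopology = TopologicalSpace.induced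
      equivSquare inferInstance :=
    (@induced_id Square alexandroffTopology).symm
  obtain ⟨m, hm⟩ : ∃ m : I, m ∈ Ioo 0 1 := ⟨_, half_mem_Ioo⟩
  have mk_eq : ∀ x y : I, equivSquare (x, y) = mk x y :=
    fun _ _ ↦ rfl
  have hc := isInvariant_nonCutPoints
  have hd := isInvariant_diagonal
  have hs := isInvariant_sides
  have md : ∀ x y : I, mk x y ∈ diagonal ↔ x = y := fun _ _ ↦ Iff.rfl
  have ms : ∀ x y : I, mk x y ∈ sides ↔ x = 0 ∨ x = 1 := fun _ _ ↦ Iff.rfl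
  have mc : ∀ x y : I, x ≠ y → (mk x y ∈ nonCutPoints ↔ y = 0 ∨ y = 1) :=
    fun x y h ↦ isPreconnected_compl_iff (p := mk x y) h
  rw [hind]
  refine homeoOrbitSpace_induced _ _ ?_ ?_ ?_ ?_
  · rintro ⟨x, y⟩
    simp only [mem_insert_iff, mem_singleton_iff, exists_eq_or_imp, exists_eq_left, P₁, P₂, P₃, P₄,
      L₁, L₂, L₃, L₄, Δ, openSquare, mem_union, mem_prod, mem_sdiff, mem_ofPred_eq, Prod.mk.injEq,
      mem_Ioo_iff_ne]
    grind
  · obtain ⟨m', hm1, hm2⟩ := exists_between hm.2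
    rintro s (rfl | rfl | rfl | rfl | rfl | rfl)
    · exact ⟨P₁, .inl rfl⟩
    · exact ⟨P₂, .inl rfl⟩
    · exact ⟨(0, m), .inl ⟨rfl, hm⟩⟩
    · exact ⟨(m, 1), .inl ⟨hm, rfl⟩⟩
    · refine ⟨(m, m), rfl, ?_⟩
      simp [P₁, P₃, hm.1.ne', hm.2.ne]
    · exact ⟨(m, m'), ⟨hm, hm.1.trans hm1, hm2⟩, hm1.ne⟩
  · rintro s (rfl | rfl | rfl | rfl | rfl | rfl)
    · refine ⟨mk 0 0, ?_⟩
      rintro x (rfl | rfl)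
      · exact Homogeneous.refl _
      · simpa using! homogeneous_symm 1 1
    · refine ⟨mk 0 1, ?_⟩
      rintro x (rfl | rfl)
      · exact Homogeneous.refl _
      · simpa using! homogeneous_symm 1 0
    · refine ⟨mk 0 m, ?_⟩
      rintro ⟨x, y⟩ (⟨rfl, hy⟩ | ⟨rfl, hy⟩)
      · exact homogeneous_left hy hm
      · have := homogeneous_symm 1 y
        rw [symm_one] at this
        exact this.trans (homogeneous_left (symm_mem_Ioo hy) hm)
    · refine ⟨mk m 0, ?_⟩
      rintro ⟨x, y⟩ (⟨hx, rfl⟩ | ⟨hx, rfl⟩)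
      · have := homogeneous_symm x 1
        rw [symm_one] at this
        exact this.trans (homogeneous_bottom (symm_mem_Ioo hx) hm)
      · exact homogeneous_bottom hx hm
    · refine ⟨mk m m, ?_⟩
      rintro ⟨x, y⟩ ⟨h : x = y, hne⟩
      subst h
      refine homogeneous_diag (mem_Ioo_iff_ne.2 ?_) hm
      simpa [P₁, P₃] using hne
    · obtain ⟨m', hm1, hm2⟩ := exists_between hm.2
      refine ⟨mk m m', ?_⟩
      rintro ⟨x, y⟩ ⟨⟨hx, hy⟩, hne : x ≠ y⟩
      rcases lt_or_gt_of_ne hne with h | h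
      · exact homogeneous_of_lt hx.1 h hy.2 hm.1 hm1 hm2
      -- The half turn exchanges the two open triangles on either side of the diagonal.
      · exact (homogeneous_symm x y).trans (homogeneous_of_lt (symm_mem_Ioo hx).1
          (strictAnti_symm h) (symm_mem_Ioo hy).2 hm.1 hm1 hm2)
  · have conv : ∀ {s : Set Square} {t : Set AlexandroffSquare}, IsInvariant t →
        (∀ x y : I, (x, y) ∈ s ↔ mk x y ∈ t) →
        IsInvariant (equivSquare.symm ⁻¹' s) := by
      intro s t ht h
      convert! ht
      ext ⟨x, y⟩
      exact h x y
    rintro s (rfl | rfl | rfl | rfl | rfl | rfl)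
    -- Each class is a Boolean combination of the three invariant sets. Non-cut points are used only
    -- off the diagonal, where `mc` describes them.
    on_goal 1 => refine conv (hd.inter hs) ?_
    on_goal 2 => refine conv ((hd.compl.inter hs).inter hc) ?_
    on_goal 3 => refine conv ((hd.compl.inter hs).inter hc.compl) ?_
    on_goal 4 => refine conv ((hd.compl.inter hs.compl).inter hc) ?_
    on_goal 5 => refine conv (hd.inter hs.compl) ?_
    on_goal 6 => refine conv ((hd.compl.inter hs.compl).inter hc.compl) ?_
    all_goals
      intro x y
      by_cases hxy : x = y
      · subst hxy
        simp only [mem_insert_iff, mem_singleton_iff, P₁, P₂, P₃, P₄,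
          L₁, L₂, L₃, L₄, Δ, openSquare, mem_union, mem_prod, mem_sdiff, mem_ofPred_eq,
          Prod.mk.injEq, mem_Ioo_iff_ne, mem_inter_iff, mem_compl_iff, md, ms]
        grind [zero_ne_one (α := I)]
      · simp only [mem_insert_iff, mem_singleton_iff, P₁, P₂, P₃, P₄,
          L₁, L₂, L₃, L₄, Δ, openSquare, mem_union, mem_prod, mem_sdiff, mem_ofPred_eq,
          Prod.mk.injEq, mem_Ioo_iff_ne, mem_inter_iff, mem_compl_iff, md, ms, mc x y hxy]
        grind [zero_ne_one (α := I)]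

end AlexandroffSquare

/-! ### The lexicographically ordered square -/

namespace LexSquare

local instance : TopologicalSpace (I ×ₗ I) := Preorder.topology _

local instance : OrderTopology (I ×ₗ I) := ⟨rfl⟩

/-- The point of the lexicographic square with the given coordinates. -/
def mk (x y : I) : I ×ₗ I := toLex (x, y)

/-- The first coordinate. -/
def fst (p : I ×ₗ I) : I := (ofLex p).1

/-- The second coordinate. -/
def snd (p : I ×ₗ I) : I := (ofLex p).2

@[simp] theorem fst_mk (x y : I) : fst (mk x y) = x := rfl
@[simp] theorem snd_mk (x y : I) : snd (mk x y) = y := rfl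
@[simp] theorem mk_fst_snd (p : I ×ₗ I) : mk (fst p) (snd p) = p := rfl

theorem mk_inj {x y s t : I} : mk x y = mk s t ↔ x = s ∧ y = t := Prod.mk_inj

theorem lt_iff {p q : I ×ₗ I} : p < q ↔ fst p < fst q ∨ fst p = fst q ∧ snd p < snd q :=
  Prod.Lex.toLex_lt_toLex

theorem le_iff {p q : I ×ₗ I} : p ≤ q ↔ fst p < fst q ∨ fst p = fst q ∧ snd p ≤ snd q :=
  Prod.Lex.toLex_le_toLex

theorem zero_le (p : I ×ₗ I) : mk 0 0 ≤ p := by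
  rw [le_iff]
  rcases eq_or_lt_of_le (nonneg' (t := fst p)) with h | h
  · exact .inr ⟨h, nonneg'⟩
  · exact .inl h

theorem le_one (p : I ×ₗ I) : p ≤ mk 1 1 := by
  rw [le_iff]
  rcases eq_or_lt_of_le (le_one' (t := fst p)) with h | h
  · exact .inr ⟨h, le_one'⟩
  · exact .inl h

theorem continuous_mk (x : I) : Continuous (mk x) := by
  refine OrderTopology.continuous_iff.2 fun a ↦ ⟨?_, ?_⟩
  · have : mk x ⁻¹' Ioi a = {y | fst a < x ∨ fst a = x ∧ snd a < y} := by
      ext y; exact lt_iff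
    rw [this]
    by_cases h : fst a < x
    · simp [h]
    by_cases h' : fst a = x
    · simpa [h'] using! isOpen_Ioi
    · simp [h, h']
  · have : mk x ⁻¹' Iio a = {y | x < fst a ∨ x = fst a ∧ y < snd a} := by
      ext y; exact lt_iff
    rw [this]
    by_cases h : x < fst a
    · simp [h]
    by_cases h' : x = fst a
    · simpa [h'] using! isOpen_Iio
    · simp [h, h']

theorem Ioo_eq_image (x : I) : Ioo (mk x 0) (mk x 1) = mk x '' Ioo 0 1 := by
  ext p
  simp only [mem_Ioo, lt_iff, fst_mk, snd_mk, mem_image]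
  constructor
  · rintro ⟨h | ⟨rfl, h⟩, h' | ⟨h1, h'⟩⟩
    · exact absurd h' h.not_gt
    · exact absurd h1 h.ne'
    · exact absurd h' (lt_irrefl _)
    · exact ⟨snd p, ⟨h, h'⟩, rfl⟩
  · rintro ⟨y, hy, rfl⟩
    exact ⟨.inr ⟨rfl, hy.1⟩, .inr ⟨rfl, hy.2⟩⟩

theorem isPreconnected_Ioo_mk (x : I) : IsPreconnected (Ioo (mk x 0) (mk x 1)) := by
  rw [Ioo_eq_image]
  exact isPreconnected_Ioo.image _ (continuous_mk x).continuousOn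

theorem isSeparable_range_mk (x : I) : TopologicalSpace.IsSeparable (range (mk x)) :=
  TopologicalSpace.isSeparable_range (continuous_mk x)

/-- An interval between different columns contains the interiors of uncountably many columns, which
are disjoint open sets. -/
theorem not_isSeparable {S : Set (I ×ₗ I)} {a b : I ×ₗ I} (hab : fst a < fst b)
    (h : Ioo a b ⊆ S) : ¬ TopologicalSpace.IsSeparable S := by
  intro hS
  refine not_countable_Ioo hab (countable_of_isSeparable fst hS fun z hz ↦ ?_)
  refine ⟨Ioo (mk z 0) (mk z 1), isOpen_Ioo, ?_, ?_⟩ <;> rw [Ioo_eq_image]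
  · exact ⟨mk z _, ⟨_, half_mem_Ioo, rfl⟩, h ⟨lt_iff.2 (.inl hz.1), lt_iff.2 (.inl hz.2)⟩⟩
  · rintro _ ⟨y, -, rfl⟩
    rfl

/-- Column interiors are open and separable. A neighbourhood of an end of a column spills into the
adjacent columns, except at the least and greatest points, which have no columns beyond them. -/
theorem mem_separablePoints_iff (x y : I) :
    mk x y ∈ separablePoints (I ×ₗ I) ↔ y ∈ Ioo 0 1 ∨ x = 0 ∧ y = 0 ∨ x = 1 ∧ y = 1 := by
  constructor
  · rintro ⟨U, hU, hs⟩
    rcases eq_zero_or_mem_Ioo_or_eq_one y with rfl | hy | rfl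
    · refine .inr (.inl ⟨?_, rfl⟩)
      by_contra hx
      obtain ⟨l, hl, hlU⟩ := exists_Ioc_subset_of_mem_nhds hU
        ⟨mk 0 0, lt_iff.2 (.inl (pos_iff_ne_zero.2 hx))⟩
      refine not_isSeparable ?_ (Ioo_subset_Ioc_self.trans hlU) hs
      rcases lt_iff.1 hl with h | h
      · exact h
      · exact absurd h.2 (not_lt.2 nonneg')
    · exact .inl hy
    · refine .inr (.inr ⟨?_, rfl⟩)
      by_contra hx
      obtain ⟨l, hl, hlU⟩ := exists_Ico_subset_of_mem_nhds hU
        ⟨mk 1 1, lt_iff.2 (.inl (lt_of_le_of_ne le_one' hx))⟩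
      refine not_isSeparable ?_ (Ioo_subset_Ico_self.trans hlU) hs
      rcases lt_iff.1 hl with h | h
      · exact h
      · exact absurd h.2 (not_lt.2 le_one')
  · rintro (hy | ⟨rfl, rfl⟩ | ⟨rfl, rfl⟩)
    · refine ⟨Ioo (mk x 0) (mk x 1), isOpen_Ioo.mem_nhds ?_, (isSeparable_range_mk x).mono ?_⟩
      · rw [Ioo_eq_image]
        exact ⟨y, hy, rfl⟩
      · rw [Ioo_eq_image]
        exact image_subset_range _ _
    · refine ⟨Iio (mk 0 1), isOpen_Iio.mem_nhds (lt_iff.2 (.inr ⟨rfl, zero_lt_one⟩)),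
        (isSeparable_range_mk 0).mono fun p hp ↦ ?_⟩
      rcases lt_iff.1 hp with h | h
      · exact absurd h (not_lt.2 nonneg')
      · exact ⟨snd p, mk_inj.2 ⟨h.1.symm, rfl⟩⟩
    · refine ⟨Ioi (mk 1 0), isOpen_Ioi.mem_nhds (lt_iff.2 (.inr ⟨rfl, zero_lt_one⟩)),
        (isSeparable_range_mk 1).mono fun p hp ↦ ?_⟩
      rcases lt_iff.1 hp with h | h
      · exact absurd h (not_lt.2 le_one')
      · exact ⟨snd p, mk_inj.2 ⟨h.1, rfl⟩⟩

/-- The points that do not cut some neighbourhood. -/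
def nonCutPoints : Set (I ×ₗ I) := {p | ∃ U, IsOpen U ∧ p ∈ U ∧ IsPreconnected (U \ {p})}

theorem isInvariant_nonCutPoints : IsInvariant nonCutPoints := by
  rintro h p ⟨U, hU, hp, hc⟩
  refine ⟨h '' U, h.isOpenMap _ hU, mem_image_of_mem h hp, ?_⟩
  rw [← image_singleton, ← image_sdiff h.injective]
  exact hc.image h h.continuous.continuousOn

/-- The order is dense and preconnected sets are order-convex, so deleting a point with neighbours
on both sides disconnects every open set around it. At the two extreme points a half-open column
works: deleting the extreme point leaves an open column. -/
theorem mem_nonCutPoints_iff (x y : I) :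
    mk x y ∈ nonCutPoints ↔ x = 0 ∧ y = 0 ∨ x = 1 ∧ y = 1 := by
  constructor
  · rintro ⟨U, hU, hp, hc⟩
    rw [← mk_inj, ← mk_inj]
    generalize mk x y = p at *
    by_contra! hne
    obtain ⟨l, hl, hlU⟩ := exists_Ioc_subset_of_mem_nhds (hU.mem_nhds hp)
      ⟨mk 0 0, lt_of_le_of_ne (zero_le p) hne.1.symm⟩
    obtain ⟨r, hr, hrU⟩ := exists_Ico_subset_of_mem_nhds (hU.mem_nhds hp)
      ⟨mk 1 1, lt_of_le_of_ne (le_one p) hne.2⟩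
    obtain ⟨a, hla, hap⟩ := exists_between hl
    obtain ⟨b, hpb, hbr⟩ := exists_between hr
    exact (hc.Icc_subset ⟨hlU ⟨hla, hap.le⟩, hap.ne⟩ ⟨hrU ⟨hpb.le, hbr⟩, hpb.ne'⟩
      ⟨hap.le, hpb.le⟩).2 rfl
  · rintro (⟨rfl, rfl⟩ | ⟨rfl, rfl⟩)
    · refine ⟨Iio (mk 0 1), isOpen_Iio, lt_iff.2 (.inr ⟨rfl, zero_lt_one⟩), ?_⟩
      convert! isPreconnected_Ioo_mk 0 using 1
      ext p
      simp [lt_iff_le_and_ne (a := mk 0 0), zero_le, and_comm, eq_comm]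
    · refine ⟨Ioi (mk 1 0), isOpen_Ioi, lt_iff.2 (.inr ⟨rfl, zero_lt_one⟩), ?_⟩
      convert! isPreconnected_Ioo_mk 1 using 1
      ext p
      simp [lt_iff_le_and_ne (b := mk 1 1), le_one]

/-- The points lying on a connected separable set that contains a non-cut point. -/
def sides : Set (I ×ₗ I) :=
  {p | ∃ c ∈ nonCutPoints, ∃ C, IsPreconnected C ∧ TopologicalSpace.IsSeparable C ∧ c ∈ C ∧ p ∈ C}

theorem isInvariant_sides : IsInvariant sides := by
  rintro h p ⟨c, hc, C, hC, hs, hcC, hpC⟩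
  exact ⟨h c, isInvariant_nonCutPoints h hc, h '' C, hC.image h h.continuous.continuousOn,
    hs.image h.continuous, mem_image_of_mem h hcC, mem_image_of_mem h hpC⟩

theorem fst_eq_of_isPreconnected {C : Set (I ×ₗ I)} (hC : IsPreconnected C)
    (hs : TopologicalSpace.IsSeparable C) {p q : I ×ₗ I} (hp : p ∈ C) (hq : q ∈ C) :
    fst p = fst q := by
  by_contra hne
  rcases lt_or_gt_of_ne hne with h | h
  · exact not_isSeparable h (Ioo_subset_Icc_self.trans (hC.Icc_subset hp hq)) hs
  · exact not_isSeparable h (Ioo_subset_Icc_self.trans (hC.Icc_subset hq hp)) hs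

theorem mem_sides_iff (x y : I) : mk x y ∈ sides ↔ x = 0 ∨ x = 1 := by
  constructor
  · rintro ⟨c, hc, C, hC, hs, hcC, hpC⟩
    have h : x = fst c := fst_eq_of_isPreconnected hC hs hpC hcC
    have hc : mk (fst c) (snd c) ∈ nonCutPoints := hc
    rw [mem_nonCutPoints_iff] at hc
    rw [h]
    exact hc.imp And.left And.left
  · intro hx
    -- For `x` equal to 0 or 1, the extreme point on the column of `x` is `(x, x)`.
    have hc : mk x x ∈ nonCutPoints :=
      (mem_nonCutPoints_iff x x).2 (hx.imp (fun h ↦ ⟨h, h⟩) fun h ↦ ⟨h, h⟩)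
    exact ⟨_, hc, range (mk x), isPreconnected_range (continuous_mk x), isSeparable_range_mk x,
      ⟨x, rfl⟩, ⟨y, rfl⟩⟩

theorem homogeneous_of_orderIso (g k : I ≃o I) (x y : I) :
    Homogeneous (mk x y) (mk (g x) (k y)) :=
  ⟨(Prod.Lex.prodLexCongr g k).toHomeomorph, rfl⟩

/-- The half turn of the lexicographic square. -/
def halfTurn (p : I ×ₗ I) : I ×ₗ I := mk (σ (fst p)) (σ (snd p))

theorem halfTurn_halfTurn (p : I ×ₗ I) : halfTurn (halfTurn p) = p := by simp [halfTurn]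

theorem halfTurn_lt_iff {p q : I ×ₗ I} : halfTurn p < q ↔ halfTurn q < p := by
  simp only [lt_iff, halfTurn, fst_mk, snd_mk]
  have : σ (fst p) = fst q ↔ σ (fst q) = fst p :=
    ⟨fun h ↦ by rw [← h, symm_symm], fun h ↦ by rw [← h, symm_symm]⟩
  rw [symm_lt_comm, symm_lt_comm (i := snd p), this]

/-- The half turn reverses the lexicographic order, so it exchanges the two kinds of open rays. -/
theorem homogeneous_symm (x y : I) : Homogeneous (mk x y) (mk (σ x) (σ y)) := by
  have hc : Continuous halfTurn := by
    refine OrderTopology.continuous_iff.2 fun a ↦ ⟨?_, ?_⟩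
    · convert! isOpen_Iio (a := halfTurn a) using 1
      ext p
      simpa [halfTurn_halfTurn] using (halfTurn_lt_iff (p := halfTurn a) (q := halfTurn p))
    · convert! isOpen_Ioi (a := halfTurn a) using 1
      ext p
      exact halfTurn_lt_iff
  exact ⟨⟨⟨halfTurn, halfTurn, halfTurn_halfTurn, halfTurn_halfTurn⟩, hc, hc⟩, rfl⟩

theorem homogeneous_left {y y' : I} (hy : y ∈ Ioo 0 1) (hy' : y' ∈ Ioo 0 1) :
    Homogeneous (mk 0 y) (mk 0 y') := by
  obtain ⟨g, rfl⟩ := exists_orderIso hy hy'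
  simpa using homogeneous_of_orderIso g g 0 y

theorem homogeneous_bottom {x x' : I} (hx : x ∈ Ioo 0 1) (hx' : x' ∈ Ioo 0 1) :
    Homogeneous (mk x 0) (mk x' 0) := by
  obtain ⟨g, rfl⟩ := exists_orderIso hx hx'
  simpa using homogeneous_of_orderIso g g x 0

theorem homogeneous_interior {x y x' y' : I} (hx : x ∈ Ioo 0 1) (hy : y ∈ Ioo 0 1)
    (hx' : x' ∈ Ioo 0 1) (hy' : y' ∈ Ioo 0 1) : Homogeneous (mk x y) (mk x' y') := by
  obtain ⟨g, rfl⟩ := exists_orderIso hx hx'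
  obtain ⟨k, rfl⟩ := exists_orderIso hy hy'
  exact homogeneous_of_orderIso g k x y

theorem orbitSpace_eq : homeoOrbitSpace lexTopology =
    {{P₁, P₃}, {P₂, P₄}, L₁ ∪ L₃, L₂ ∪ L₄, openSquare} := by
  obtain ⟨m, hm⟩ : ∃ m : I, m ∈ Ioo 0 1 := ⟨_, half_mem_Ioo⟩
  have ht := isInvariant_nonCutPoints
  have hn := isInvariant_separablePoints (I ×ₗ I)
  have hs := isInvariant_sides
  refine homeoOrbitSpace_induced (X := I ×ₗ I) toLex _ ?_ ?_ ?_ ?_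
  · rintro ⟨x, y⟩
    simp only [mem_insert_iff, mem_singleton_iff, exists_eq_or_imp, exists_eq_left, P₁, P₂, P₃, P₄,
      L₁, L₂, L₃, L₄, openSquare, mem_union, mem_prod, Prod.mk.injEq, mem_Ioo_iff_ne]
    grind
  · rintro s (rfl | rfl | rfl | rfl | rfl)
    · exact ⟨P₁, .inl rfl⟩
    · exact ⟨P₂, .inl rfl⟩
    · exact ⟨(0, m), .inl ⟨rfl, hm⟩⟩
    · exact ⟨(m, 1), .inl ⟨hm, rfl⟩⟩
    · exact ⟨(m, m), hm, hm⟩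
  · rintro s (rfl | rfl | rfl | rfl | rfl)
    · refine ⟨mk 0 0, ?_⟩
      rintro x (rfl | rfl)
      · exact Homogeneous.refl _
      · simpa using! homogeneous_symm 1 1
    · refine ⟨mk 0 1, ?_⟩
      rintro x (rfl | rfl)
      · exact Homogeneous.refl _
      · simpa using! homogeneous_symm 1 0
    · refine ⟨mk 0 m, ?_⟩
      rintro ⟨x, y⟩ (⟨rfl, hy⟩ | ⟨rfl, hy⟩)
      · exact homogeneous_left hy hm
      · have := homogeneous_symm 1 y
        rw [symm_one] at this
        exact this.trans (homogeneous_left (symm_mem_Ioo hy) hm)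
    · refine ⟨mk m 0, ?_⟩
      rintro ⟨x, y⟩ (⟨hx, rfl⟩ | ⟨hx, rfl⟩)
      · have := homogeneous_symm x 1
        rw [symm_one] at this
        exact this.trans (homogeneous_bottom (symm_mem_Ioo hx) hm)
      · exact homogeneous_bottom hx hm
    · refine ⟨mk m m, ?_⟩
      rintro ⟨x, y⟩ ⟨hx, hy⟩
      exact homogeneous_interior hx hy hm hm
  · have conv : ∀ {s : Set Square} {t : Set (I ×ₗ I)}, IsInvariant t →
        (∀ x y : I, (x, y) ∈ s ↔ mk x y ∈ t) →
        IsInvariant ((toLex : Square ≃ I ×ₗ I).symm ⁻¹' s) := by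
      intro s t ht h
      convert! ht
      ext p
      exact h (fst p) (snd p)
    rintro s (rfl | rfl | rfl | rfl | rfl)
    -- Local non-cutting gives `P₁` and `P₃`; on and off the vertical sides, separability then
    -- distinguishes column ends from column interiors.
    on_goal 1 => refine conv ht ?_
    on_goal 2 => refine conv ((ht.compl.inter hs).inter hn.compl) ?_
    on_goal 3 => refine conv ((ht.compl.inter hs).inter hn) ?_
    on_goal 4 => refine conv (hs.compl.inter hn.compl) ?_
    on_goal 5 => refine conv (hs.compl.inter hn) ?_
    all_goals
      intro x y
      simp only [mem_insert_iff, mem_singleton_iff, P₁, P₂, P₃, P₄, L₁, L₂, L₃, L₄, openSquare,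
        mem_union, mem_prod, Prod.mk.injEq, mem_Ioo_iff_ne, mem_inter_iff, mem_compl_iff,
        mem_nonCutPoints_iff, mem_sides_iff, mem_separablePoints_iff]
    all_goals grind [zero_ne_one (α := I)]

end LexSquare

/-! ### The Euclidean square -/

/-- Followed by the continuous coordinate map, the inclusion becomes a product of subtype
inclusions, which is inducing; hence it is inducing itself. -/
theorem euclideanTopology_eq : euclideanTopology = instTopologicalSpaceProd := by
  have hf : Continuous
      (fun p : Square ↦ (!₂[(p.1 : ℝ), (p.2 : ℝ)] : EuclideanSpace ℝ (Fin 2))) := by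
    refine (PiLp.continuous_toLp 2 _).comp (continuous_pi fun i ↦ ?_)
    fin_cases i
    · exact continuous_subtype_val.comp continuous_fst
    · exact continuous_subtype_val.comp continuous_snd
  have hg : Continuous (fun v : EuclideanSpace ℝ (Fin 2) ↦ (v 0, v 1)) := by fun_prop
  exact (IsInducing.of_comp hf hg
    ((IsInducing.subtypeVal (t := I)).prodMap (IsInducing.subtypeVal (t := I)))).eq_induced.symm

/-- The inclusion of the unit square in the complex plane. -/
def toComplex (p : Square) : ℂ := ⟨p.1, p.2⟩

theorem continuous_toComplex : Continuous toComplex :=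
  Complex.equivRealProdCLM.symm.continuous.comp
    ((continuous_subtype_val.comp continuous_fst).prodMk
      (continuous_subtype_val.comp continuous_snd))

theorem toComplex_injective : Function.Injective toComplex := fun _ _ h ↦
  Prod.ext (Subtype.ext (congrArg Complex.re h)) (Subtype.ext (congrArg Complex.im h))

theorem isEmbedding_toComplex : IsEmbedding toComplex :=
  (continuous_toComplex.isClosedEmbedding toComplex_injective).isEmbedding

theorem range_toComplex : range toComplex = Icc 0 1 ×ℂ Icc 0 1 := by
  ext z
  constructor
  · rintro ⟨p, rfl⟩
    exact ⟨p.1.2, p.2.2⟩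
  · rintro ⟨h, h'⟩
    exact ⟨(⟨z.re, h⟩, ⟨z.im, h'⟩), rfl⟩

theorem mem_openSquare_iff (p : Square) :
    p ∈ openSquare ↔ toComplex p ∈ interior (range toComplex) := by
  rw [range_toComplex, Complex.interior_reProdIm, interior_Icc]
  rfl

theorem homogeneous_of_image_eq (φ : ℂ ≃ₜ ℂ) (h : φ '' range toComplex = range toComplex)
    {p q : Square} (hpq : φ (toComplex p) = toComplex q) : Homogeneous p q := by
  let e := isEmbedding_toComplex.toHomeomorph
  let ψ : range toComplex ≃ₜ range toComplex := φ.subtype fun x ↦ by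
    conv_rhs => rw [← h]
    exact φ.injective.mem_set_image.symm
  refine ⟨(e.trans ψ).trans e.symm, ?_⟩
  simp only [Homeomorph.trans_apply, Homeomorph.symm_apply_eq]
  exact Subtype.ext hpq

/-- A homeomorphism of the plane takes this convex body to the unit disc and its frontier to the
circle. Conjugating the rotation by the quotient of the two image points gives the required map. -/
theorem homogeneous_boundary {p q : Square} (hp : p ∉ openSquare) (hq : q ∉ openSquare) :
    Homogeneous p q := by
  have hcl : IsClosed (range toComplex) :=
    (continuous_toComplex.isClosedEmbedding toComplex_injective).isClosed_range
  have hcv : Convex ℝ (range toComplex) := by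
    rw [range_toComplex]
    exact ((convex_Icc 0 1).linear_preimage Complex.reLm).inter
      ((convex_Icc 0 1).linear_preimage Complex.imLm)
  have hne : (interior (range toComplex)).Nonempty :=
    ⟨_, (mem_openSquare_iff (_, _)).1 ⟨half_mem_Ioo, half_mem_Ioo⟩⟩
  have hb : Bornology.IsBounded (range toComplex) :=
    (isCompact_range continuous_toComplex).isBounded
  obtain ⟨h, -, h1, h2⟩ := exists_homeomorph_image_interior_closure_frontier_eq_unitBall hcv hne hb
  rw [hcl.closure_eq] at h1
  have norm_eq : ∀ x ∉ openSquare, ‖h (toComplex x)‖ = 1 := by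
    intro x hx
    rw [← mem_sphere_zero_iff_norm, ← h2, hcl.frontier_eq]
    exact mem_image_of_mem h ⟨⟨x, rfl⟩, (mem_openSquare_iff x).not.1 hx⟩
  have hp0 : h (toComplex p) ≠ 0 := by
    rw [← norm_ne_zero_iff, norm_eq p hp]
    exact one_ne_zero
  let c : Circle := ⟨h (toComplex q) / h (toComplex p), by
    rw [← SetLike.mem_coe, Submonoid.coe_unitSphere, mem_sphere_zero_iff_norm, norm_div,
      norm_eq p hp, norm_eq q hq, div_one]⟩
  refine homogeneous_of_image_eq ((h.trans (rotation c).toHomeomorph).trans h.symm) ?_ ?_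
  · change (h.symm ∘ (rotation c).toHomeomorph ∘ h) '' _ = _
    rw [image_comp, image_comp, h1]
    have : (rotation c).toHomeomorph '' Metric.closedBall (0 : ℂ) 1 = Metric.closedBall 0 1 := by
      simp
    rw [this, ← h1, ← image_comp, Homeomorph.symm_comp_self, image_id]
  · simp only [Homeomorph.trans_apply, Homeomorph.symm_apply_eq]
    change h (toComplex q) / h (toComplex p) * h (toComplex p) = _
    exact div_mul_cancel₀ _ hp0

theorem homogeneous_openSquare {p q : Square} (hp : p ∈ openSquare) (hq : q ∈ openSquare) :
    Homogeneous p q := by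
  obtain ⟨g, hg⟩ := exists_orderIso hp.1 hq.1
  obtain ⟨k, hk⟩ := exists_orderIso hp.2 hq.2
  exact ⟨g.toHomeomorph.prodCongr k.toHomeomorph, Prod.ext hg hk⟩

/-- The points on whose complement every circle-valued map has a continuous argument. -/
def argumentPoints (X : Type*) [TopologicalSpace X] : Set X :=
  {p | ∀ f : C(({p}ᶜ : Set X), Circle), ∃ g : C(({p}ᶜ : Set X), ℝ), ∀ x, Circle.exp (g x) = f x}

theorem isInvariant_argumentPoints (X : Type*) [TopologicalSpace X] :
    IsInvariant (argumentPoints X) := by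
  intro h p hp f
  let E : ({p}ᶜ : Set X) ≃ₜ ({h p}ᶜ : Set X) := h.subtype fun x ↦ by simp
  obtain ⟨g, hg⟩ := hp (f.comp ⟨E, E.continuous⟩)
  refine ⟨g.comp ⟨E.symm, E.symm.continuous⟩, fun x ↦ ?_⟩
  have := hg (E.symm x)
  simpa using this

/-- A circle-valued map on a contractible space has a continuous argument. -/
theorem exists_argument {A : Type*} [TopologicalSpace A] [ContractibleSpace A] (f : C(A, Circle)) :
    ∃ g : C(A, ℝ), ∀ x, Circle.exp (g x) = f x := by
  obtain ⟨y, ⟨H⟩⟩ := (id_nullhomotopic A).comp_right f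
  have hy : Circle.exp (Complex.arg y) = y := Circle.exp_arg y
  -- The reversed null-homotopy starts at the constant `y`, which lifts to `arg y`; the time-one end
  -- of its lift is an argument of `f`.
  let G := Circle.isCoveringMap_exp.liftHomotopy H.symm.toContinuousMap
    (ContinuousMap.const A (Complex.arg y)) fun a ↦ by simp [hy]
  refine ⟨G.comp ((ContinuousMap.const A 1).prodMk (ContinuousMap.id A)), fun x ↦ ?_⟩
  have := congrFun (Circle.isCoveringMap_exp.liftHomotopy_lifts H.symm.toContinuousMap
    (ContinuousMap.const A (Complex.arg y)) fun a ↦ by simp [hy]) (1, x)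
  simpa [G] using! this

/-- Without a boundary point the square is still star-shaped about its centre, hence contractible.
-/
theorem mem_argumentPoints_of_notMem {p : Square} (hp : p ∉ openSquare) :
    p ∈ argumentPoints Square := by
  intro f
  let j : ({p}ᶜ : Set Square) → ℂ := fun q ↦ toComplex q
  have hj : IsEmbedding j := isEmbedding_toComplex.comp IsEmbedding.subtypeVal
  have hstar : StarConvex ℝ (⟨1 / 2, 1 / 2⟩ : ℂ) (range j) := by
    rintro _ ⟨⟨q, hq⟩, rfl⟩ a b ha hb hab
    obtain ⟨⟨q₁, hq₁⟩, ⟨q₂, hq₂⟩⟩ := q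
    have mem : ∀ t ∈ Icc (0 : ℝ) 1, a * (1 / 2) + b * t ∈ Icc (0 : ℝ) 1 := fun t ht ↦
      ⟨by nlinarith [ht.1], by nlinarith [ht.2]⟩
    refine ⟨⟨(⟨_, mem q₁ hq₁⟩, ⟨_, mem q₂ hq₂⟩), ?_⟩, ?_⟩
    · rintro rfl
      -- With `a = 0` the point is `q` itself; with `a > 0` the centre has positive weight and the
      -- point is interior. Neither can be `p`.
      rcases ha.eq_or_lt with rfl | ha
      · obtain rfl : b = 1 := by linarith
        exact hq (Prod.ext (Subtype.ext (by simp)) (Subtype.ext (by simp)))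
      · have mem' : ∀ t (ht : t ∈ Icc (0 : ℝ) 1),
            (⟨a * (1 / 2) + b * t, mem t ht⟩ : I) ∈ Ioo 0 1 := fun t ht ↦ by
          constructor <;> rw [← Subtype.coe_lt_coe]
          · change 0 < a * (1 / 2) + b * t
            nlinarith [ht.1]
          · change a * (1 / 2) + b * t < 1
            nlinarith [ht.2]
        exact hp ⟨mem' _ hq₁, mem' _ hq₂⟩
    · apply Complex.ext <;> simp [j, toComplex]
  have hne : (range j).Nonempty := by
    rw [range_nonempty_iff_nonempty]
    exact ⟨(_, _), fun h ↦ hp (h ▸ ⟨half_mem_Ioo, half_mem_Ioo⟩)⟩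
  have := hstar.contractibleSpace hne
  have := hj.toHomeomorph.contractibleSpace
  exact exists_argument f

/-- The direction of `q - p` has no continuous argument: along a small circle around `p` it would
grow by `2π`, although the circle closes up. -/
theorem notMem_argumentPoints {p : Square} (hp : p ∈ openSquare) : p ∉ argumentPoints Square := by
  intro hlift
  obtain ⟨⟨a, ha⟩, ⟨b, hb⟩⟩ := p
  obtain ⟨⟨ha0, ha1⟩, ⟨hb0, hb1⟩⟩ := hp
  rw [← Subtype.coe_lt_coe] at ha0 ha1 hb0 hb1
  change 0 < a at ha0
  change a < 1 at ha1
  change 0 < b at hb0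
  change b < 1 at hb1
  -- A radius for which the circle around `p` stays in the closed square.
  obtain ⟨r, hr, hra, hra', hrb, hrb'⟩ :
      ∃ r : ℝ, 0 < r ∧ r ≤ a ∧ r ≤ 1 - a ∧ r ≤ b ∧ r ≤ 1 - b :=
    ⟨min (min a (1 - a)) (min b (1 - b)), by simp [*], by simp, by simp, by simp, by simp⟩
  set p : Square := (⟨a, ha⟩, ⟨b, hb⟩) with hp
  have hne : ∀ q : ({p}ᶜ : Set Square), ‖toComplex q - toComplex p‖ ≠ 0 := fun q ↦
    norm_ne_zero_iff.2 (sub_ne_zero.2 fun h ↦ q.2 (toComplex_injective h))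
  let f : C(({p}ᶜ : Set Square), Circle) :=
    ⟨fun q ↦ ⟨(toComplex q - toComplex p) / ‖toComplex q - toComplex p‖, by
      rw [← SetLike.mem_coe, Submonoid.coe_unitSphere, mem_sphere_zero_iff_norm, norm_div,
        Complex.norm_real, norm_norm, div_self (hne q)]⟩, by
      have := continuous_toComplex.comp (continuous_subtype_val (p := (· ∈ ({p}ᶜ : Set Square))))
      refine Continuous.subtype_mk (Continuous.div (this.sub continuous_const) ?_ ?_) _
      · exact Complex.continuous_ofReal.comp (this.sub continuous_const).norm
      · exact fun q ↦ Complex.ofReal_ne_zero.2 (hne q)⟩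
  obtain ⟨g, hg⟩ := hlift f
  have mem : ∀ c s : ℝ, r ≤ c → r ≤ 1 - c → |s| ≤ 1 → c + r * s ∈ Icc (0 : ℝ) 1 := by
    intro c s h h' hs
    have := abs_le.1 hs
    constructor <;> nlinarith
  let δ : ℝ → Square := fun t ↦
    (⟨a + r * Real.cos t, mem _ _ hra hra' (Real.abs_cos_le_one t)⟩,
      ⟨b + r * Real.sin t, mem _ _ hrb hrb' (Real.abs_sin_le_one t)⟩)
  have hδc : Continuous δ := by
    refine Continuous.prodMk (Continuous.subtype_mk ?_ _) (Continuous.subtype_mk ?_ _) <;> fun_prop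
  have hδ : ∀ t, toComplex (δ t) - toComplex p = r * (Circle.exp t : ℂ) := by
    intro t
    rw [Circle.coe_exp, Complex.exp_mul_I, ← Complex.ofReal_cos, ← Complex.ofReal_sin]
    apply Complex.ext <;> simp [toComplex, δ, hp, -Complex.ofReal_cos, -Complex.ofReal_sin]
  have hδ' : ∀ t, ‖toComplex (δ t) - toComplex p‖ = r := by
    intro t
    rw [hδ, norm_mul, Circle.norm_coe, Complex.norm_real, mul_one, Real.norm_of_nonneg hr.le]
  have hδp : ∀ t, δ t ∈ ({p}ᶜ : Set Square) := by
    intro t ht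
    have := hδ' t
    rw [show δ t = p from ht, sub_self, norm_zero] at this
    exact hr.ne this
  let γ : ℝ → ({p}ᶜ : Set Square) := fun t ↦ ⟨δ t, hδp t⟩
  have hγ : Continuous γ := hδc.subtype_mk _
  have hf : ∀ t, Circle.exp (g (γ t)) = Circle.exp t := by
    intro t
    rw [hg]
    apply Circle.ext
    change (toComplex (δ t) - toComplex p) / (‖toComplex (δ t) - toComplex p‖ : ℂ) = _
    rw [hδ', hδ]
    exact mul_div_cancel_left₀ _ (Complex.ofReal_ne_zero.2 hr.ne')
  have h0 : Circle.exp (g (γ 0)) = 1 := by rw [hf, Circle.exp_zero]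
  -- Both sides lift `t ↦ Circle.exp t` through the covering and agree at 0; `h0` makes the right
  -- side a lift.
  have key : (fun t ↦ g (γ t)) = fun t ↦ t + g (γ 0) := by
    refine Circle.isCoveringMap_exp.eq_of_comp_eq (g.continuous.comp hγ) (by fun_prop) ?_ 0
      (by simp)
    funext t
    simp [hf, Circle.exp_add]
  have h1 := congrFun key (2 * Real.pi)
  have h2 : γ (2 * Real.pi) = γ 0 := by
    simp [γ, δ]
  simp only [h2] at h1
  linarith [Real.pi_pos]

theorem orbitSpace_euclideanTopology_eq :
    homeoOrbitSpace euclideanTopology = {openSquare, openSquareᶜ} := by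
  have hinv : IsInvariant openSquareᶜ := by
    convert! isInvariant_argumentPoints Square using 1
    ext p
    exact ⟨mem_argumentPoints_of_notMem, fun h h' ↦ notMem_argumentPoints h' h⟩
  rw [euclideanTopology_eq, ← induced_id (t := instTopologicalSpaceProd)]
  refine homeoOrbitSpace_induced (Equiv.refl Square) _ ?_ ?_ ?_ ?_
  · intro p
    by_cases hp : p ∈ openSquare
    · exact ⟨_, .inl rfl, hp⟩
    · exact ⟨_, .inr rfl, hp⟩
  · rintro s (rfl | rfl)
    · exact ⟨(_, _), half_mem_Ioo, half_mem_Ioo⟩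
    · exact ⟨P₁, fun h ↦ h.1.1.ne rfl⟩
  · rintro s (rfl | rfl)
    · exact ⟨(_, _), fun x hx ↦ homogeneous_openSquare hx ⟨half_mem_Ioo, half_mem_Ioo⟩⟩
    · exact ⟨P₁, fun x hx ↦ homogeneous_boundary hx fun h ↦ h.1.1.ne rfl⟩
  · rintro s (rfl | rfl)
    · simpa using hinv.compl
    · exact hinv

end Square

theorem mainTheorem3 :
    Square.homeoOrbitSpace Square.alexandroffTopology =
      {{Square.P₁, Square.P₃}, {Square.P₂, Square.P₄},
        Square.L₁ ∪ Square.L₃, Square.L₂ ∪ Square.L₄,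
        Square.Δ \ {Square.P₁, Square.P₃}, Square.openSquare \ Square.Δ} ∧
    Square.homeoOrbitSpace Square.lexTopology =
      {{Square.P₁, Square.P₃}, {Square.P₂, Square.P₄},
        Square.L₁ ∪ Square.L₃, Square.L₂ ∪ Square.L₄,
        Square.openSquare} ∧
    Square.homeoOrbitSpace Square.euclideanTopology =
      {Square.openSquare, Square.openSquareᶜ} :=
  ⟨Square.AlexandroffSquare.orbitSpace_eq, Square.LexSquare.orbitSpace_eq,
    Square.orbitSpace_euclideanTopology_eq⟩
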